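/- Let $H$ be a hypergraph on a finite vertex set $V$, i.e. a collection of nonempty subsets (edges) of $V$, such that every edge is inclusion-minimal among the edges and has size at least $2$. Its independence complex $I(H)$ is the simplicial complex of all $W\subseteq V$ that contain no edge of $H$. For a sequence of distinct vertices $v_1,\dots,v_n$, the $k$-uniform tight path $P_{n,k}$ on $v_1,\dots,v_n$ is the hypergraph with vertices $v_1,\dots,v_n$ whose edges are the sets of $k$ consecutive vertices $\{v_i,v_{i+1},\dots,v_{i+k-1}\}$, $1\le i\le n-k+1$. Let $k\ge 2$, and suppose that $H$ contains as a subgraph the $k$-uniform tight path $P_{2k-2,k}$ on distinct vertices $a_1,\dots,a_{2k-2}$. Let $\mathcal L_k(H)$ be the hypergraph obtained from $H$ by deleting all edges of this $P_{2k-2,k}$, and adding $k+1$ new vertices $b_1,\dots,b_{k+1}$ and all edges of the tight path $P_{3k-1,k}$ on $a_1,\dots,a_{k-1},b_1,\dots,b_{k+1},a_k,\dots,a_{2k-2}$. Then $$I(\mathcal L_k(H))\simeq \Sigma^{k-1} I(H),$$ that is, the geometric realization of $I(\mathcal L_k(H))$ is homotopy equivalent to the $(k-1)$-fold (unreduced)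 suspension of the geometric realization of $I(H)$, where $\Sigma X$ is the quotient of $X\times[0,1]$ that identifies $X\times\{0\}$ to one point and $X\times\{1\}$ to one point. -/

import Mathlib

universe u

/-- A set `e` of vertices is independent in `H` if it contains no edge of `H`. The independence
complex of `H` consists of the independent subsets of the vertex set. Mathlib's convention is that
the empty face of an abstract simplicial complex is not listed. -/
def Hypergraph.independenceComplex {α : Type u} (H : Hypergraph α) :
    PreAbstractSimplicialComplex α where
  faces := {s | s.Nonempty ∧ (s : Set α) ⊆ H.vertexSet ∧ ∀ e ∈ H.edgeSet, ¬ e ⊆ (s : Set α)}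
  isRelLowerSet_faces := by
    rintro s ⟨hne, hV, hE⟩
    refine ⟨hne, fun t hts ht => ⟨ht, ?_, fun e he h => hE e he ?_⟩⟩
    · exact (Finset.coe_subset.2 hts).trans hV
    · exact h.trans (Finset.coe_subset.2 hts)

/-- The geometric realization, in barycentric coordinates: a point is a family of nonnegative
weights on the vertices with sum `1` whose support is contained in a face. It is used for complexes
with finitely many faces only, and carries the subspace topology from `α → ℝ`. -/
def PreAbstractSimplicialComplex.realization {α : Type u} (K : PreAbstractSimplicialComplex α) :
    Set (α → ℝ) :=
  {x | ∃ s ∈ K.faces, (∀ i, 0 ≤ x i) ∧ (∀ i, i ∉ s → x i = 0) ∧ ∑ i ∈ s, x i = 1}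

/-- The polyhedron of the independence complex, as a topological space. -/
def Hypergraph.independenceSpace {α : Type u} (H : Hypergraph α) : TopCat.{u} :=
  TopCat.of H.independenceComplex.realization

/-- The relation on `X × [0,1]` that identifies `X × {0}` to one point and `X × {1}` to one
point. -/
def suspensionSetoid (X : Type u) : Setoid (X × unitInterval) where
  r p q := p = q ∨ (p.2 = 0 ∧ q.2 = 0) ∨ (p.2 = 1 ∧ q.2 = 1)
  iseqv :=
    { refl := fun _ => Or.inl rfl
      symm := by
        rintro p q (h | ⟨h, h'⟩ | ⟨h, h'⟩)
        · exact Or.inl h.symm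
        · exact Or.inr (Or.inl ⟨h', h⟩)
        · exact Or.inr (Or.inr ⟨h', h⟩)
      trans := by
        rintro p q r (rfl | ⟨h, h'⟩ | ⟨h, h'⟩) (rfl | ⟨g, g'⟩ | ⟨g, g'⟩)
        · exact Or.inl rfl
        · exact Or.inr (Or.inl ⟨g, g'⟩)
        · exact Or.inr (Or.inr ⟨g, g'⟩)
        · exact Or.inr (Or.inl ⟨h, h'⟩)
        · exact Or.inr (Or.inl ⟨h, g'⟩)
        · exact absurd (h'.symm.trans g) zero_ne_one
        · exact Or.inr (Or.inr ⟨h, h'⟩)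
        · exact absurd (g.symm.trans h') zero_ne_one
        · exact Or.inr (Or.inr ⟨h, g'⟩) }

/-- The (unreduced) suspension of a nonempty space, with the quotient topology. -/
def suspension (X : TopCat.{u}) : TopCat.{u} :=
  TopCat.of (Quotient (suspensionSetoid X))

/-- The `k`-uniform tight path on the sequence of vertices `v 0, …, v (n - 1)`: its edges are the
sets of `k` consecutive vertices. -/
def tightPath {α : Type u} (k : ℕ) {n : ℕ} (v : Fin n → α) : Hypergraph α where
  vertexSet := Set.range v
  edgeSet := {e | ∃ i : ℕ, i + k ≤ n ∧ e = v '' {j | i ≤ (j : ℕ) ∧ (j : ℕ) < i + k}}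
  subset_vertexSet_of_mem_edgeSet' := by
    rintro e ⟨i, -, rfl⟩
    exact Set.image_subset_range _ _

/-- `H` contains `P` as a subgraph. -/
def Hypergraph.Contains {α : Type u} (H P : Hypergraph α) : Prop :=
  P.vertexSet ⊆ H.vertexSet ∧ P.edgeSet ⊆ H.edgeSet

/-- The sequence `a_1, …, a_{k-1}, b_1, …, b_{k+1}, a_k, …, a_{2k-2}` obtained by inserting the `k + 1`
new vertices `b_j` in the middle of the sequence `a` (indexed from `0` here). The old vertices are
in the left summand and the new vertices form the right summand. -/
def insertedSequence {α : Type u} (k : ℕ) (a : Fin (2 * k - 2) → α) :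
    Fin (3 * k - 1) → α ⊕ Fin (k + 1) :=
  fun i =>
    if h₁ : (i : ℕ) < k - 1 then Sum.inl (a ⟨i, by omega⟩)
    else if h₂ : (i : ℕ) < 2 * k then Sum.inr ⟨i - (k - 1), by omega⟩
    else Sum.inl (a ⟨i - (k + 1), by omega⟩)

/-- The hypergraph obtained from `H` by deleting all edges of the tight path on `a`, and adding
`k + 1` new vertices and the edges of the tight path on the longer sequence. -/
def Hypergraph.tightSubdivision {α : Type u} (H : Hypergraph α) (k : ℕ)
    (a : Fin (2 * k - 2) → α) (ha : Set.range a ⊆ H.vertexSet) : Hypergraph (α ⊕ Fin (k + 1)) where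
  vertexSet := Sum.inl '' H.vertexSet ∪ Set.range Sum.inr
  edgeSet := (fun e => Sum.inl '' e) '' (H.edgeSet \ (tightPath k a).edgeSet) ∪
    (tightPath k (insertedSequence k a)).edgeSet
  subset_vertexSet_of_mem_edgeSet' := by
    rintro e (⟨e, ⟨he, -⟩, rfl⟩ | ⟨i, -, rfl⟩)
    · exact (Set.image_mono (H.subset_vertexSet_of_mem_edgeSet' he)).trans Set.subset_union_left
    · rintro _ ⟨j, -, rfl⟩
      unfold insertedSequence
      split_ifs
      · exact Or.inl ⟨_, ha ⟨_, rfl⟩, rfl⟩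
      · exact Or.inr ⟨_, rfl⟩
      · exact Or.inl ⟨_, ha ⟨_, rfl⟩, rfl⟩

/-! The proof replaces nonfaces of a simplicial complex one at a time. If `e` is a face and `w ∉ e` a
vertex such that every face containing `e` stays a face when `w` is added (the link of `e` is a cone
with apex `w`), then removing all faces that contain `e` does not change the homotopy type: the
mass `min_{i ∈ e} x i` is pushed from each vertex of `e` to `w` along straight lines. Read in the
other direction this allows to discard a nonface. This is `homotopyEquiv_insert_nonface`.

Write `E_p` (`leftEdge`) for the edge of the long path with `p` old vertices before the first `k - p`
new ones, and `F_q` (`rightEdge`) for the edge with `q` old vertices after the last `k - q` new ones,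
`0 ≤ p, q < k`. In the complex of the subdivision the link of every edge of the short path is a cone,
so these edges can be added as nonfaces. Now the nonfaces are the edges of `H` and all `E_p` and
`F_q`. In their presence `E_{k-1}, …, E_1` can be discarded in this order, with the last new vertex
as apex, and then `F_{k-1}, …, F_1`, with the first new vertex as apex. What is left on the new
vertices are the two nonfaces `{b_1, …, b_k}` and `{b_2, …, b_{k+1}}`; the link of `b_{k+1}` is then a
cone with apex `b_1`, and deleting `b_{k+1}` leaves the join of `I(H)` with the boundary of the simplex
on `b_1, …, b_k`.

Finally the nonface `{b_1, …, b_{n+1}}` can be exchanged for `{b_1, …, b_n}` and `{b_{n+1}, d}` with a new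
vertex `d` (`homotopyEquiv_joinBoundary_succ`), and the join with the two points `b_{n+1}` and `d` is a
suspension (`homotopyEquiv_suspension_polyhedron`). After `k - 1` such steps the remaining nonface is
`{b_1}`, and only `I(H)` is left. -/

/-! ### Complexes given by nonfaces -/

/-- The complex on the finite vertex set `V` whose minimal nonfaces are the minimal members of `N`:
its faces are the nonempty subsets of `V` that contain no member of `N`. Unlike the edges of a
`Hypergraph`, the members of `N` are arbitrary, so that a singleton in `N` deletes a vertex. -/
def nonfaceComplex {β : Type u} (V : Finset β) (N : Set (Set β)) :
    PreAbstractSimplicialComplex β where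
  faces := {s | s.Nonempty ∧ s ⊆ V ∧ ∀ e ∈ N, ¬ e ⊆ (s : Set β)}
  isRelLowerSet_faces := by
    rintro s ⟨hne, hV, hE⟩
    refine ⟨hne, fun t hts ht => ⟨ht, hts.trans hV, fun e he h => hE e he ?_⟩⟩
    exact h.trans (Finset.coe_subset.2 hts)

/-- The polyhedron of `nonfaceComplex V N`. -/
abbrev polyhedron {β : Type u} (V : Finset β) (N : Set (Set β)) : TopCat.{u} :=
  TopCat.of (nonfaceComplex V N).realization

section Realization

variable {β : Type u} {V : Finset β} {N N' : Set (Set β)}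

/-- With a fixed finite vertex set, no face has to be chosen to describe the realization. -/
theorem mem_realization_nonfaceComplex {x : β → ℝ} :
    x ∈ (nonfaceComplex V N).realization ↔ (∀ i, 0 ≤ x i) ∧ (∀ i, i ∉ V → x i = 0) ∧
      ∑ i ∈ V, x i = 1 ∧ ∀ e ∈ N, ∃ i ∈ e, x i = 0 := by
  classical
  constructor
  · rintro ⟨s, ⟨-, hsV, hs⟩, h0, hsupp, hsum⟩
    refine ⟨h0, fun i hi => hsupp i fun h => hi (hsV h), ?_, fun e he => ?_⟩
    · rw [← hsum]
      exact (Finset.sum_subset hsV fun i _ hi => hsupp i hi).symm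
    · obtain ⟨i, hie, his⟩ := Set.not_subset.1 (hs e he)
      exact ⟨i, hie, hsupp i his⟩
  · rintro ⟨h0, hV, hsum, hN⟩
    have hs : ∑ i ∈ V.filter (fun i => x i ≠ 0), x i = 1 := by
      rw [Finset.sum_filter_ne_zero, hsum]
    refine ⟨V.filter (fun i => x i ≠ 0), ⟨?_, Finset.filter_subset _ _, fun e he hsub => ?_⟩,
      h0, fun i hi => ?_, hs⟩
    · rw [Finset.nonempty_iff_ne_empty]
      intro h
      simp [h] at hs
    · obtain ⟨i, hie, hi⟩ := hN e he
      have := hsub hie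
      simp [hi] at this
    · by_contra hne
      exact hi (Finset.mem_filter.2 ⟨by_contra fun h => hne (hV i h), hne⟩)

/-- Only the minimal members of `N` matter. -/
theorem nonfaceComplex_congr (h : ∀ f ∈ N, ∃ g ∈ N', g ⊆ f) (h' : ∀ f ∈ N', ∃ g ∈ N, g ⊆ f) :
    nonfaceComplex V N = nonfaceComplex V N' := by
  have key : ∀ {M M' : Set (Set β)}, (∀ f ∈ M, ∃ g ∈ M', g ⊆ f) →
      (nonfaceComplex V M').faces ⊆ (nonfaceComplex V M).faces := by
    rintro M M' h s ⟨hne, hV, hs⟩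
    refine ⟨hne, hV, fun f hf hfs => ?_⟩
    obtain ⟨g, hg, hgf⟩ := h f hf
    exact hs g hg (hgf.trans hfs)
  have hfaces := Set.Subset.antisymm (key h') (key h)
  cases hA : nonfaceComplex V N
  cases hB : nonfaceComplex V N'
  rw [hA, hB] at hfaces
  simp only at hfaces
  subst hfaces
  rfl

theorem polyhedron_congr (h : ∀ f ∈ N, ∃ g ∈ N', g ⊆ f) (h' : ∀ f ∈ N', ∃ g ∈ N, g ⊆ f) :
    polyhedron V N = polyhedron V N' := by
  rw [polyhedron, polyhedron, nonfaceComplex_congr h h']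

instance compactSpace_polyhedron : CompactSpace (polyhedron V N) := by
  refine isCompact_iff_compactSpace.1 (?_ : IsCompact (nonfaceComplex V N).realization)
  have hU : (nonfaceComplex V N).realization =
      ⋃ s ∈ (nonfaceComplex V N).faces,
        {x : β → ℝ | (∀ i, 0 ≤ x i) ∧ (∀ i, i ∉ s → x i = 0) ∧ ∑ i ∈ s, x i = 1} := by
    ext x
    simp only [PreAbstractSimplicialComplex.realization, Set.mem_iUnion, exists_prop]
    rfl
  rw [hU]
  refine Set.Finite.isCompact_biUnion ?_ fun s _ => ?_
  · exact V.powerset.finite_toSet.subset fun s hs => by simpa using hs.2.1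
  · refine (isCompact_univ_pi fun _ : β => isCompact_Icc (a := (0 : ℝ)) (b := 1)).of_isClosed_subset
      ?_ ?_
    · simp only [Set.ofPred_and, Set.ofPred_forall]
      refine (isClosed_iInter fun i => isClosed_le continuous_const (continuous_apply i)).inter
        ((isClosed_iInter fun i => isClosed_iInter fun _ =>
          isClosed_eq (continuous_apply i) continuous_const).inter
        (isClosed_eq (by fun_prop) continuous_const))
    · rintro x ⟨h0, hs, hsum⟩ i -
      refine ⟨h0 i, ?_⟩
      by_cases hi : i ∈ s
      · exact hsum ▸ Finset.single_le_sum (fun j _ => h0 j) hi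
      · simp [hs i hi]

instance t2Space_polyhedron : T2Space (polyhedron V N) :=
  inferInstanceAs (T2Space (nonfaceComplex V N).realization)

end Realization

/-! ### Faces whose link is a cone -/

section Move

variable {β : Type u} {V : Finset β} {N : Set (Set β)}

open Classical in
/-- The point obtained from `x` by moving a fraction `t` of the largest multiple of the barycentre
of `e` that `x` contains to the vertex `w`. -/
noncomputable def pushMass (e : Finset β) (he : e.Nonempty) (w : β) (t : ℝ) (x : β → ℝ) : β → ℝ :=
  fun i => x i - t * e.inf' he x * (if i ∈ e then 1 else 0) +
    t * e.inf' he x * (if i = w then (e.card : ℝ) else 0)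

theorem continuous_pushMass (e : Finset β) (he : e.Nonempty) (w : β) :
    Continuous fun p : ℝ × (β → ℝ) => pushMass e he w p.1 p.2 := by
  have hm : Continuous fun p : ℝ × (β → ℝ) => e.inf' he p.2 :=
    Continuous.finset_inf'_apply he fun i _ => (continuous_apply i).comp continuous_snd
  unfold pushMass
  fun_prop

theorem pushMass_eq_self {e : Finset β} {he : e.Nonempty} {w : β} {t : ℝ} {x : β → ℝ}
    (h : t * e.inf' he x = 0) : pushMass e he w t x = x := by
  ext i
  simp [pushMass, h]

theorem inf'_eq_zero {e : Finset β} (he : e.Nonempty) {x : β → ℝ} (h0 : ∀ i, 0 ≤ x i)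
    (h : ∃ i ∈ e, x i = 0) : e.inf' he x = 0 := by
  obtain ⟨i, hi, hxi⟩ := h
  exact le_antisymm (hxi ▸ Finset.inf'_le x hi) (Finset.le_inf' he x fun j _ => h0 j)

/-- The faces that contain `e` form a cone with apex `w`, so mass may be moved from `e` to `w`. -/
theorem pushMass_mem {e : Finset β} (he : e.Nonempty) {w : β} (heV : e ⊆ V) (hwV : w ∈ V)
    (hcone : ∀ f ∈ N, w ∈ f → ∃ g ∈ N, g ⊆ (f \ {w}) ∪ (e : Set β))
    {t : ℝ} (ht0 : 0 ≤ t) (ht1 : t ≤ 1) {x : β → ℝ} (hx : x ∈ (nonfaceComplex V N).realization) :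
    pushMass e he w t x ∈ (nonfaceComplex V N).realization := by
  classical
  by_cases hm : t * e.inf' he x = 0
  · rwa [pushMass_eq_self hm]
  rw [mem_realization_nonfaceComplex] at hx ⊢
  obtain ⟨h0, hV, hsum, hN⟩ := hx
  have hm0 : 0 ≤ e.inf' he x := Finset.le_inf' he x fun j _ => h0 j
  have htm : 0 ≤ t * e.inf' he x := mul_nonneg ht0 hm0
  have hle : ∀ i ∈ e, t * e.inf' he x ≤ x i := fun i hi =>
    (mul_le_of_le_one_left hm0 ht1).trans (Finset.inf'_le x hi)
  have hpos : ∀ i ∈ e, x i ≠ 0 := fun i hi h => hm (by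
    rw [inf'_eq_zero he h0 ⟨i, hi, h⟩, mul_zero])
  refine ⟨fun i => ?_, fun i hi => ?_, ?_, fun f hf => ?_⟩
  · have h1 : 0 ≤ t * e.inf' he x * (if i = w then (e.card : ℝ) else 0) :=
      mul_nonneg htm (by split_ifs <;> positivity)
    have h2 : t * e.inf' he x * (if i ∈ e then 1 else 0) ≤ x i := by
      split_ifs with hi
      · simpa using hle i hi
      · simpa using h0 i
    simp only [pushMass]
    convert add_nonneg (sub_nonneg.2 h2) h1 using 3
  · have hie : i ∉ e := fun h => hi (heV h)
    have hiw : i ≠ w := fun h => hi (h ▸ hwV)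
    simp [pushMass, hie, hiw, hV i hi]
  · simp only [pushMass, Finset.sum_add_distrib, Finset.sum_sub_distrib, ← Finset.mul_sum, hsum]
    simp [Finset.inter_eq_right.2 heV, hwV]
  · by_contra! hf0
    have hsub : ∀ i ∈ f, i ≠ w → x i ≠ 0 := by
      intro i hi hiw hxi
      have hie : i ∉ e := fun h => hpos i h hxi
      exact hf0 i hi (by simp [pushMass, hie, hiw, hxi])
    by_cases hwf : w ∈ f
    · obtain ⟨g, hg, hgf⟩ := hcone f hf hwf
      obtain ⟨i, hig, hi⟩ := hN g hg
      rcases hgf hig with ⟨h1, h2⟩ | h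
      · exact hsub i h1 h2 hi
      · exact hpos i h hi
    · obtain ⟨i, hif, hi⟩ := hN f hf
      exact hsub i hif (fun h => hwf (h ▸ hif)) hi

theorem pushMass_one_mem {e : Finset β} (he : e.Nonempty) {w : β} (heV : e ⊆ V) (hwV : w ∈ V)
    (hwe : w ∉ e) (hcone : ∀ f ∈ N, w ∈ f → ∃ g ∈ N, g ⊆ (f \ {w}) ∪ (e : Set β))
    {x : β → ℝ} (hx : x ∈ (nonfaceComplex V N).realization) :
    pushMass e he w 1 x ∈ (nonfaceComplex V (insert (e : Set β) N)).realization := by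
  have h := mem_realization_nonfaceComplex.1
    (pushMass_mem he heV hwV hcone zero_le_one le_rfl hx)
  rw [mem_realization_nonfaceComplex]
  refine ⟨h.1, h.2.1, h.2.2.1, ?_⟩
  rintro f (rfl | hf)
  · obtain ⟨i, hi, hmin⟩ := Finset.exists_mem_eq_inf' he x
    have hiw : i ≠ w := fun h => hwe (h ▸ hi)
    exact ⟨i, hi, by simp [pushMass, hiw, hi, hmin]⟩
  · exact h.2.2.2 f hf

/-- If the link of a face `e` is a cone with apex `w`, then all faces that contain `e` can be removed
without changing the homotopy type. The hypothesis `hcone` expresses the cone condition in terms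
of nonfaces. -/
theorem homotopyEquiv_insert_nonface {e : Set β} {w : β} (he : e.Nonempty) (heV : e ⊆ V)
    (hwV : w ∈ V) (hwe : w ∉ e) (hcone : ∀ f ∈ N, w ∈ f → ∃ g ∈ N, g ⊆ (f \ {w}) ∪ e) :
    Nonempty (ContinuousMap.HomotopyEquiv (polyhedron V N) (polyhedron V (insert e N))) := by
  lift e to Finset β using V.finite_toSet.subset heV
  rw [Finset.coe_nonempty] at he
  rw [Finset.coe_subset] at heV
  rw [Finset.mem_coe] at hwe
  have hincl : ∀ x, x ∈ (nonfaceComplex V (insert (e : Set β) N)).realization →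
      x ∈ (nonfaceComplex V N).realization := by
    intro x hx
    rw [mem_realization_nonfaceComplex] at hx ⊢
    exact ⟨hx.1, hx.2.1, hx.2.2.1, fun f hf => hx.2.2.2 f (Or.inr hf)⟩
  let r : C((nonfaceComplex V N).realization,
      (nonfaceComplex V (insert (e : Set β) N)).realization) :=
    { toFun := fun x => ⟨pushMass e he w 1 x, pushMass_one_mem he heV hwV hwe hcone x.2⟩
      continuous_toFun := ((continuous_pushMass e he w).comp
        (continuous_const.prodMk continuous_subtype_val)).subtype_mk _ }
  let ι : C((nonfaceComplex V (insert (e : Set β) N)).realization,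
      (nonfaceComplex V N).realization) :=
    { toFun := fun x => ⟨x, hincl x x.2⟩
      continuous_toFun := continuous_subtype_val.subtype_mk _ }
  refine ⟨⟨r, ι, ⟨ContinuousMap.Homotopy.symm ⟨⟨fun p => ⟨pushMass e he w p.1 p.2.1,
    pushMass_mem he heV hwV hcone p.1.2.1 p.1.2.2 p.2.2⟩, ?_⟩, ?_, ?_⟩⟩, ?_⟩⟩
  · exact ((continuous_pushMass e he w).comp ((continuous_subtype_val.comp continuous_fst).prodMk
      (continuous_subtype_val.comp continuous_snd))).subtype_mk _
  · intro x
    exact Subtype.ext (pushMass_eq_self (by simp))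
  · intro x
    rfl
  · have : r.comp ι = ContinuousMap.id _ := by
      ext1 x
      have hx := mem_realization_nonfaceComplex.1 x.2
      refine Subtype.ext (pushMass_eq_self ?_)
      rw [one_mul]
      exact inf'_eq_zero he hx.1 (hx.2.2.2 _ (Or.inl rfl))
    exact this ▸ ContinuousMap.Homotopic.refl _

/-- Iterated removal of the faces containing `G 0`, `G 1`, …, `G (n - 1)`. -/
theorem homotopyEquiv_union_nonfaces (G : ℕ → Set β) (w : ℕ → β) (n : ℕ)
    (hne : ∀ p < n, (G p).Nonempty) (hV : ∀ p < n, G p ⊆ V) (hwV : ∀ p < n, w p ∈ V)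
    (hw : ∀ p < n, w p ∉ G p)
    (hcone : ∀ p < n, ∀ f ∈ N ∪ G '' {j | j < p}, w p ∈ f →
      ∃ g ∈ N ∪ G '' {j | j < p}, g ⊆ (f \ {w p}) ∪ G p) :
    Nonempty (ContinuousMap.HomotopyEquiv (polyhedron V N)
      (polyhedron V (N ∪ G '' {j | j < n}))) := by
  induction n with
  | zero =>
    have : N ∪ G '' {j | j < 0} = N := by simp
    rw [this]
    exact ⟨ContinuousMap.HomotopyEquiv.refl _⟩
  | succ n ih =>
    obtain ⟨φ⟩ := ih (fun p hp => hne p (by omega)) (fun p hp => hV p (by omega))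
      (fun p hp => hwV p (by omega)) (fun p hp => hw p (by omega))
      (fun p hp => hcone p (by omega))
    obtain ⟨ψ⟩ := homotopyEquiv_insert_nonface (hne n n.lt_succ_self) (hV n n.lt_succ_self)
      (hwV n n.lt_succ_self) (hw n n.lt_succ_self) (hcone n n.lt_succ_self)
    have hset : insert (G n) (N ∪ G '' {j | j < n}) = N ∪ G '' {j | j < n + 1} := by
      have : {j | j < n + 1} = insert n {j | j < n} := by
        ext j
        simp only [Set.mem_ofPred_eq, Set.mem_insert_iff]
        omega
      rw [this, Set.image_insert_eq, Set.union_insert]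
    rw [hset] at ψ
    exact ⟨φ.trans ψ⟩

end Move

/-! ### Suspension and homotopy equivalence -/

section Suspension

/-- The map of suspensions induced by a continuous map. -/
def suspensionMap {X Y : TopCat.{u}} (f : C(X, Y)) : C(suspension X, suspension Y) where
  toFun := Quotient.lift (s := suspensionSetoid X)
    (fun p => (Quotient.mk (suspensionSetoid Y) (f p.1, p.2))) (by
      rintro p q (rfl | h)
      · rfl
      · exact Quotient.sound (Or.inr h))
  continuous_toFun := Continuous.quotient_lift
    (continuous_quotient_mk'.comp (f := fun p : X × unitInterval => (f p.1, p.2))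
      (by fun_prop)) _

theorem suspensionMap_homotopic {X Y : TopCat.{u}} {f g : C(X, Y)} (h : f.Homotopic g) :
    (suspensionMap f).Homotopic (suspensionMap g) := by
  obtain ⟨F⟩ := h
  -- A product of a quotient map with the interval is handled by currying.
  let A : C(X × unitInterval, C(unitInterval, suspension Y)) := ContinuousMap.curry
    { toFun := fun p => Quotient.mk (suspensionSetoid Y) (F (p.2, p.1.1), p.1.2)
      continuous_toFun := continuous_quotient_mk'.comp
        (f := fun p : (X × unitInterval) × unitInterval => (F (p.2, p.1.1), p.1.2))
        (by fun_prop) }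
  let B : C(suspension X, C(unitInterval, suspension Y)) :=
    { toFun := Quotient.lift (s := suspensionSetoid X) A (by
        rintro p q (rfl | h)
        · rfl
        · ext t
          exact Quotient.sound (Or.inr h))
      continuous_toFun := Continuous.quotient_lift A.continuous _ }
  refine ⟨⟨⟨fun p => B p.2 p.1, by fun_prop⟩, ?_, ?_⟩⟩
  · rintro ⟨p⟩
    change Quotient.mk (suspensionSetoid Y) (F (0, p.1), p.2) = Quotient.mk _ (f p.1, p.2)
    rw [F.apply_zero]
  · rintro ⟨p⟩
    change Quotient.mk (suspensionSetoid Y) (F (1, p.1), p.2) = Quotient.mk _ (g p.1, p.2)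
    rw [F.apply_one]

/-- Suspension preserves homotopy equivalence. -/
theorem homotopyEquiv_suspension {X Y : TopCat.{u}} (h : Nonempty (ContinuousMap.HomotopyEquiv X Y)) :
    Nonempty (ContinuousMap.HomotopyEquiv (suspension X) (suspension Y)) := by
  obtain ⟨φ⟩ := h
  have hid : ∀ Z : TopCat.{u}, suspensionMap (ContinuousMap.id Z) = ContinuousMap.id _ := by
    intro Z
    ext ⟨p⟩
    rfl
  have hcomp : ∀ {Z W T : TopCat.{u}} (g : C(W, T)) (f : C(Z, W)),
      (suspensionMap g).comp (suspensionMap f) = suspensionMap (g.comp f) := by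
    intro Z W T g f
    ext ⟨p⟩
    rfl
  refine ⟨⟨suspensionMap φ.toFun, suspensionMap φ.invFun, ?_, ?_⟩⟩
  · rw [hcomp, ← hid]
    exact suspensionMap_homotopic φ.left_inv
  · rw [hcomp, ← hid]
    exact suspensionMap_homotopic φ.right_inv

end Suspension

/-! ### Join with two points -/

section Join

variable {β : Type u} {V : Finset β} {N : Set (Set β)}

open Classical in
/-- The point of the join with the two vertices `c` and `d` that has parameter `t` on the segments
from `c` to `z` to `d`. -/
noncomputable def joinPoint (c d : β) (z : β → ℝ) (t : ℝ) : β → ℝ := fun i =>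
  (1 - |2 * t - 1|) * z i + max 0 (1 - 2 * t) * (if i = c then 1 else 0) +
    max 0 (2 * t - 1) * (if i = d then 1 else 0)

theorem abs_sub_max_identity (s : ℝ) : 1 - |s| + max 0 (-s) + max 0 s = 1 := by
  rcases le_total 0 s with h | h
  · rw [abs_of_nonneg h, max_eq_left (by linarith), max_eq_right h]; ring
  · rw [abs_of_nonpos h, max_eq_right (by linarith), max_eq_left h]; ring

/-- The join of a complex with two points `c` and `d` is its suspension: the map from the compact
suspension to the Hausdorff join is a continuous bijection. The rest has to be nonempty, because the suspension of the empty space is empty. -/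
theorem homotopyEquiv_suspension_polyhedron {c d : β} (hcd : c ≠ d) (hc : c ∈ V) (hd : d ∈ V)
    (hNc : ∀ e ∈ N, c ∉ e) (hNd : ∀ e ∈ N, d ∉ e)
    (hne : Nonempty (polyhedron V (N ∪ {{c}, {d}}))) :
    Nonempty (ContinuousMap.HomotopyEquiv (polyhedron V (insert {c, d} N))
      (suspension (polyhedron V (N ∪ {{c}, {d}})))) := by
  classical
  have hZ : ∀ z : polyhedron V (N ∪ {{c}, {d}}), (∀ i, 0 ≤ z.1 i) ∧ (∀ i, i ∉ V → z.1 i = 0) ∧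
      ∑ i ∈ V, z.1 i = 1 ∧ (∀ e ∈ N, ∃ i ∈ e, z.1 i = 0) ∧ z.1 c = 0 ∧ z.1 d = 0 := by
    intro z
    obtain ⟨h0, hV, hs, hN⟩ := mem_realization_nonfaceComplex.1 z.2
    refine ⟨h0, hV, hs, fun e he => hN e (Or.inl he), ?_, ?_⟩
    · simpa using hN {c} (by simp)
    · simpa using hN {d} (by simp)
  have hmem : ∀ (z : polyhedron V (N ∪ {{c}, {d}})) (t : unitInterval),
      joinPoint c d z.1 t ∈ (nonfaceComplex V (insert {c, d} N)).realization := by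
    rintro z ⟨t, ht0, ht1⟩
    obtain ⟨h0, hV, hs, hN, hzc, hzd⟩ := hZ z
    rw [mem_realization_nonfaceComplex]
    refine ⟨fun i => ?_, fun i hi => ?_, ?_, ?_⟩
    · have h1 : 0 ≤ 1 - |2 * t - 1| := by
        rw [sub_nonneg, abs_le]; constructor <;> linarith
      have := h0 i
      simp only [joinPoint]
      positivity
    · have hic : i ≠ c := fun h => hi (h ▸ hc)
      have hid : i ≠ d := fun h => hi (h ▸ hd)
      simp [joinPoint, hV i hi, hic, hid]
    · have := abs_sub_max_identity (2 * t - 1)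
      simp only [joinPoint, Finset.sum_add_distrib, ← Finset.mul_sum, hs]
      simp only [Finset.sum_ite_eq', hc, hd, if_true, mul_one]
      rw [neg_sub] at this
      exact this
    · rintro e (rfl | he)
      · rcases le_total (2 * t) 1 with h | h
        · exact ⟨d, by simp, by simp [joinPoint, hzd, hcd.symm, h]⟩
        · exact ⟨c, by simp, by simp [joinPoint, hzc, hcd, h]⟩
      · obtain ⟨i, hie, hi⟩ := hN e he
        have hic : i ≠ c := fun h => hNc e he (h ▸ hie)
        have hid : i ≠ d := fun h => hNd e he (h ▸ hie)
        exact ⟨i, hie, by simp [joinPoint, hi, hic, hid]⟩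
  let Φ : suspension (polyhedron V (N ∪ {{c}, {d}})) → polyhedron V (insert {c, d} N) :=
    Quotient.lift (s := suspensionSetoid _) (fun p => ⟨joinPoint c d p.1.1 p.2, hmem p.1 p.2⟩) (by
      rintro ⟨z, t⟩ ⟨z', t'⟩ (h | ⟨h, h'⟩ | ⟨h, h'⟩)
      · rw [h]
      · dsimp only at h h'
        subst h h'
        exact Subtype.ext (by ext i; simp [joinPoint])
      · dsimp only at h h'
        subst h h'
        exact Subtype.ext (by ext i; norm_num [joinPoint]))
  have hΦ : Continuous Φ := by
    refine Continuous.quotient_lift (Continuous.subtype_mk ?_ _) _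
    have h1 : Continuous fun p : polyhedron V (N ∪ {{c}, {d}}) × unitInterval => p.1.1 :=
      continuous_subtype_val.comp continuous_fst
    have h2 : Continuous fun p : polyhedron V (N ∪ {{c}, {d}}) × unitInterval => (p.2 : ℝ) :=
      continuous_subtype_val.comp continuous_snd
    unfold joinPoint
    refine continuous_pi fun i => ?_
    have h3 := (continuous_apply i).comp h1
    simp only [Function.comp_def] at h3
    fun_prop
  have hinj : Function.Injective Φ := by
    rintro ⟨z, t⟩ ⟨z', t'⟩ h
    have h' : ∀ i, joinPoint c d z.1 t i = joinPoint c d z'.1 t' i :=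
      fun i => congrFun (congrArg Subtype.val h) i
    obtain ⟨h0, hV, hs, hN, hzc, hzd⟩ := hZ z
    obtain ⟨h0', hV', hs', hN', hzc', hzd'⟩ := hZ z'
    have htt : t = t' := by
      have e1 := h' c
      have e2 := h' d
      simp only [joinPoint, hzc, hzd, hzc', hzd', hcd, hcd.symm, if_true, if_false, mul_zero,
        mul_one, zero_add, add_zero] at e1 e2
      refine Subtype.ext ?_
      rcases le_total (2 * (t : ℝ)) 1 with a1 | a1 <;> rcases le_total (2 * (t' : ℝ)) 1 with a2 | a2
      · rw [max_eq_right (by linarith), max_eq_right (by linarith)] at e1; linarith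
      · rw [max_eq_right (by linarith), max_eq_left (by linarith)] at e1
        rw [max_eq_left (by linarith), max_eq_right (by linarith)] at e2; linarith
      · rw [max_eq_left (by linarith), max_eq_right (by linarith)] at e1
        rw [max_eq_right (by linarith), max_eq_left (by linarith)] at e2; linarith
      · rw [max_eq_right (by linarith), max_eq_right (by linarith)] at e2; linarith
    subst htt
    refine Quotient.sound (s := suspensionSetoid _) ?_
    by_cases ht0 : t = 0
    · exact Or.inr (Or.inl ⟨ht0, ht0⟩)
    by_cases ht1 : t = 1
    · exact Or.inr (Or.inr ⟨ht1, ht1⟩)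
    refine Or.inl (Prod.ext (Subtype.ext (funext fun i => ?_)) rfl)
    have hpos : 1 - |2 * (t : ℝ) - 1| ≠ 0 := by
      have l0 : (0 : ℝ) < t := lt_of_le_of_ne t.2.1 fun h => ht0 (Subtype.ext h.symm)
      have l1 : (t : ℝ) < 1 := lt_of_le_of_ne t.2.2 fun h => ht1 (Subtype.ext h)
      have : |2 * (t : ℝ) - 1| < 1 := by rw [abs_lt]; constructor <;> linarith
      linarith
    have := h' i
    simp only [joinPoint, add_left_inj] at this
    exact mul_left_cancel₀ hpos this
  have hsurj : Function.Surjective Φ := by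
    intro y
    obtain ⟨h0, hV, hs, hN⟩ := mem_realization_nonfaceComplex.1 y.2
    have hcd0 : y.1 c = 0 ∨ y.1 d = 0 := by simpa using hN {c, d} (by simp)
    have hsplit : y.1 c + y.1 d + ∑ i ∈ (V.erase c).erase d, y.1 i = 1 := by
      rw [← hs, ← Finset.add_sum_erase V y.1 hc,
        ← Finset.add_sum_erase (V.erase c) y.1 (Finset.mem_erase.2 ⟨hcd.symm, hd⟩), add_assoc]
    have hrest : 0 ≤ ∑ i ∈ (V.erase c).erase d, y.1 i := Finset.sum_nonneg fun i _ => h0 i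
    have hc0 := h0 c
    have hd0 := h0 d
    let t : unitInterval := ⟨(1 - y.1 c + y.1 d) / 2, by constructor <;> linarith⟩
    have htv : 2 * (t : ℝ) - 1 = y.1 d - y.1 c := by simp only [t]; ring
    have htv' : 1 - 2 * (t : ℝ) = y.1 c - y.1 d := by linarith
    have hmax1 : max 0 (y.1 c - y.1 d) = y.1 c := by
      rcases hcd0 with h | h
      · rw [h, max_eq_left (by linarith)]
      · rw [h, sub_zero, max_eq_right hc0]
    have hmax2 : max 0 (y.1 d - y.1 c) = y.1 d := by
      rcases hcd0 with h | h
      · rw [h, sub_zero, max_eq_right hd0]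
      · rw [h, max_eq_left (by linarith)]
    have habs : 1 - |y.1 d - y.1 c| = ∑ i ∈ (V.erase c).erase d, y.1 i := by
      have := abs_sub_max_identity (y.1 d - y.1 c)
      rw [neg_sub, hmax1, hmax2] at this
      linarith
    suffices hz : ∃ z : polyhedron V (N ∪ {{c}, {d}}), ∀ i, i ≠ c → i ≠ d →
        (∑ i ∈ (V.erase c).erase d, y.1 i) * z.1 i = y.1 i by
      obtain ⟨z, hz⟩ := hz
      refine ⟨Quotient.mk (suspensionSetoid _) (z, t), Subtype.ext (funext fun i => ?_)⟩
      change joinPoint c d z.1 t i = y.1 i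
      obtain ⟨-, -, -, -, hzc, hzd⟩ := hZ z
      simp only [joinPoint, htv, htv', hmax1, hmax2, habs]
      by_cases hic : i = c
      · subst hic
        simp [hzc, hcd]
      by_cases hid : i = d
      · subst hid
        simp [hzd, hic]
      simp [hic, hid, hz i hic hid]
    rcases hrest.eq_or_lt with hu | hu
    · -- At the two suspension points any base point will do.
      obtain ⟨z⟩ := hne
      refine ⟨z, fun i hic hid => ?_⟩
      rw [← hu, zero_mul]
      by_cases hiV : i ∈ V
      · exact ((Finset.sum_eq_zero_iff_of_nonneg fun i _ => h0 i).1 hu.symm i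
          (by simp [hic, hid, hiV])).symm
      · exact (hV i hiV).symm
    · set u := ∑ i ∈ (V.erase c).erase d, y.1 i with hudef
      refine ⟨⟨fun i => if i ∈ (V.erase c).erase d then y.1 i / u else 0, ?_⟩,
        fun i hic hid => ?_⟩
      · refine mem_realization_nonfaceComplex.2 ⟨fun i => ?_, fun i hi => ?_, ?_, ?_⟩
        · have := h0 i
          split_ifs <;> positivity
        · simp [hi]
        · rw [Finset.sum_ite_mem, Finset.inter_eq_right.2
            ((Finset.erase_subset _ _).trans (Finset.erase_subset _ _)), ← Finset.sum_div,
            ← hudef, div_self hu.ne']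
        · rintro e (he | rfl | rfl)
          · obtain ⟨i, hie, hi⟩ := hN e (Or.inr he)
            exact ⟨i, hie, by simp [hi]⟩
          · exact ⟨c, rfl, by simp⟩
          · exact ⟨d, rfl, by simp⟩
      · by_cases hiV : i ∈ V
        · simp [hic, hid, hiV, mul_div_cancel₀ _ hu.ne']
        · simp [hiV, hV i hiV]
  have : CompactSpace (suspension (polyhedron V (N ∪ {{c}, {d}}))) :=
    inferInstanceAs (CompactSpace (Quotient (suspensionSetoid _)))
  exact ⟨(Continuous.homeoOfEquivCompactToT2
    (f := Equiv.ofBijective Φ ⟨hinj, hsurj⟩) hΦ).symm.toHomotopyEquiv⟩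

end Join

theorem TopCat.nonempty_homotopyEquiv_of_eq {X Y : TopCat.{u}} (h : X = Y) :
    Nonempty (ContinuousMap.HomotopyEquiv X Y) := by
  subst h
  exact ⟨ContinuousMap.HomotopyEquiv.refl _⟩

/-! ### Edges of the two tight paths -/

section Path

variable {α : Type u} {k : ℕ} (a : Fin (2 * k - 2) → α)

/-- The old vertices with positions in `[lo, hi)` in the sequence `a`. -/
def oldRun (lo hi : ℕ) : Set (α ⊕ Fin (k + 1)) :=
  (fun j => Sum.inl (a j)) '' {j | lo ≤ (j : ℕ) ∧ (j : ℕ) < hi}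

variable (α k) in
/-- The new vertices with positions in `[lo, hi)`. -/
def newRun (lo hi : ℕ) : Set (α ⊕ Fin (k + 1)) :=
  Sum.inr '' {j | lo ≤ (j : ℕ) ∧ (j : ℕ) < hi}

/-- The edge of the long path that consists of the `p` old vertices before the new ones and of the
first `k - p` new vertices. -/
def leftEdge (p : ℕ) : Set (α ⊕ Fin (k + 1)) :=
  oldRun a (k - 1 - p) (k - 1) ∪ newRun α k 0 (k - p)

/-- The edge of the long path that consists of the last `k - q` new vertices and of the `q` old
vertices after them. -/
def rightEdge (q : ℕ) : Set (α ⊕ Fin (k + 1)) :=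
  oldRun a (k - 1) (k - 1 + q) ∪ newRun α k (q + 1) (k + 1)

/-- The edge of the short path that has `p` vertices in the first half. -/
def shortEdge (p : ℕ) : Set (α ⊕ Fin (k + 1)) :=
  oldRun a (k - 1 - p) (2 * k - 1 - p)

variable {a}

theorem inr_mem_newRun {lo hi : ℕ} {j : Fin (k + 1)} :
    Sum.inr j ∈ newRun α k lo hi ↔ lo ≤ (j : ℕ) ∧ (j : ℕ) < hi := by
  simp [newRun]

theorem inl_notMem_newRun {lo hi : ℕ} {x : α} : Sum.inl x ∉ newRun α k lo hi := by
  simp [newRun]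

theorem inr_notMem_oldRun {lo hi : ℕ} {j : Fin (k + 1)} : Sum.inr j ∉ oldRun a lo hi := by
  simp [oldRun]

theorem inl_mem_oldRun {lo hi : ℕ} {x : α} :
    Sum.inl x ∈ oldRun a lo hi ↔ ∃ j : Fin (2 * k - 2), (lo ≤ (j : ℕ) ∧ (j : ℕ) < hi) ∧ a j = x := by
  simp [oldRun]

theorem inr_mem_leftEdge {p : ℕ} {j : Fin (k + 1)} :
    Sum.inr j ∈ leftEdge a p ↔ (j : ℕ) < k - p := by
  simp [leftEdge, inr_mem_newRun, inr_notMem_oldRun]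

theorem inr_mem_rightEdge {q : ℕ} {j : Fin (k + 1)} :
    Sum.inr j ∈ rightEdge a q ↔ q + 1 ≤ (j : ℕ) := by
  simp only [rightEdge, Set.mem_union, inr_notMem_oldRun, inr_mem_newRun, false_or]
  omega

theorem inr_notMem_shortEdge {p : ℕ} {j : Fin (k + 1)} : Sum.inr j ∉ shortEdge a p :=
  inr_notMem_oldRun

theorem inl_mem_leftEdge {p : ℕ} {x : α} : Sum.inl x ∈ leftEdge a p ↔
    ∃ j : Fin (2 * k - 2), (k - 1 - p ≤ (j : ℕ) ∧ (j : ℕ) < k - 1) ∧ a j = x := by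
  simp [leftEdge, inl_mem_oldRun, inl_notMem_newRun]

theorem inl_mem_rightEdge {q : ℕ} {x : α} : Sum.inl x ∈ rightEdge a q ↔
    ∃ j : Fin (2 * k - 2), (k - 1 ≤ (j : ℕ) ∧ (j : ℕ) < k - 1 + q) ∧ a j = x := by
  simp [rightEdge, inl_mem_oldRun, inl_notMem_newRun]

theorem inl_mem_shortEdge {p : ℕ} {x : α} : Sum.inl x ∈ shortEdge a p ↔
    ∃ j : Fin (2 * k - 2), (k - 1 - p ≤ (j : ℕ) ∧ (j : ℕ) < 2 * k - 1 - p) ∧ a j = x :=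
  inl_mem_oldRun

theorem edgeSet_tightPath_insertedSequence (hk : 2 ≤ k) :
    (tightPath k (insertedSequence k a)).edgeSet =
      leftEdge a '' {p | p < k} ∪ rightEdge a '' {q | q < k} := by
  have hl : ∀ p < k, insertedSequence k a '' {j | k - 1 - p ≤ (j : ℕ) ∧
      (j : ℕ) < k - 1 - p + k} = leftEdge a p := by
    intro p hp
    ext x
    constructor
    · rintro ⟨j, ⟨h1, h2⟩, rfl⟩
      unfold insertedSequence
      split_ifs with g1 g2
      · exact inl_mem_leftEdge.2 ⟨_, ⟨h1, g1⟩, rfl⟩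
      · exact inr_mem_leftEdge.2 (by simp only; omega)
      · omega
    · rcases x with x | j
      · rw [inl_mem_leftEdge]
        rintro ⟨j, ⟨h1, h2⟩, rfl⟩
        exact ⟨⟨j, by omega⟩, ⟨h1, by simp only; omega⟩, by simp [insertedSequence, h2]⟩
      · rw [inr_mem_leftEdge]
        intro h
        refine ⟨⟨j + (k - 1), by omega⟩, ⟨by simp only; omega, by simp only; omega⟩, ?_⟩
        simp [insertedSequence, show (j : ℕ) + (k - 1) < 2 * k by omega]
  have hr : ∀ q < k, insertedSequence k a '' {j | k + q ≤ (j : ℕ) ∧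
      (j : ℕ) < k + q + k} = rightEdge a q := by
    intro q hq
    ext x
    constructor
    · rintro ⟨j, ⟨h1, h2⟩, rfl⟩
      unfold insertedSequence
      split_ifs with g1 g2
      · omega
      · exact inr_mem_rightEdge.2 (by simp only; omega)
      · exact inl_mem_rightEdge.2 ⟨_, ⟨by simp only; omega, by simp only; omega⟩, rfl⟩
    · rcases x with x | j
      · rw [inl_mem_rightEdge]
        rintro ⟨j, ⟨h1, h2⟩, rfl⟩
        refine ⟨⟨j + (k + 1), by omega⟩, ⟨by simp only; omega, by simp only; omega⟩, ?_⟩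
        simp [insertedSequence, show ¬ (j : ℕ) + (k + 1) < k - 1 by omega,
          show ¬ (j : ℕ) + (k + 1) < 2 * k by omega]
      · rw [inr_mem_rightEdge]
        intro h
        refine ⟨⟨j + (k - 1), by omega⟩, ⟨by simp only; omega, by simp only; omega⟩, ?_⟩
        simp [insertedSequence, show (j : ℕ) + (k - 1) < 2 * k by omega]
  ext e
  constructor
  · rintro ⟨i, hi, rfl⟩
    rcases lt_or_ge i k with h | h
    · refine Or.inl ⟨k - 1 - i, show _ < k by omega, ?_⟩
      rw [← hl _ (by omega), show k - 1 - (k - 1 - i) = i by omega]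
    · refine Or.inr ⟨i - k, show _ < k by omega, ?_⟩
      rw [← hr _ (by omega), show k + (i - k) = i by omega]
  · rintro (⟨p, hp, rfl⟩ | ⟨q, hq, rfl⟩)
    · exact ⟨k - 1 - p, by omega, (hl p hp).symm⟩
    · have hq' : q < k := hq
      exact ⟨k + q, by omega, (hr q hq).symm⟩

theorem image_edgeSet_tightPath (hk : 2 ≤ k) :
    (fun e => (Sum.inl '' e : Set (α ⊕ Fin (k + 1)))) '' (tightPath k a).edgeSet =
      (fun p => shortEdge a (p + 1)) '' {p | p < k - 1} := by
  have h : ∀ i, (Sum.inl '' (a '' {j | i ≤ (j : ℕ) ∧ (j : ℕ) < i + k}) : Set (α ⊕ Fin (k + 1))) =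
      oldRun a i (i + k) := fun i => by rw [Set.image_image]; rfl
  ext e
  constructor
  · rintro ⟨_, ⟨i, hi, rfl⟩, rfl⟩
    refine ⟨k - 2 - i, show _ < k - 1 by omega, ?_⟩
    dsimp only
    rw [h, shortEdge, show k - 1 - (k - 2 - i + 1) = i by omega,
      show 2 * k - 1 - (k - 2 - i + 1) = i + k by omega]
  · rintro ⟨p, hp, rfl⟩
    have hp' : p < k - 1 := hp
    refine ⟨_, ⟨k - 2 - p, by omega, rfl⟩, ?_⟩
    dsimp only
    rw [h, shortEdge, show k - 1 - (p + 1) = k - 2 - p by omega,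
      show 2 * k - 1 - (p + 1) = k - 2 - p + k by omega]

theorem oldRun_subset {lo hi lo' hi' : ℕ} (h : lo' ≤ lo) (h' : hi ≤ hi') :
    oldRun a lo hi ⊆ oldRun a lo' hi' :=
  Set.image_mono fun _ hj => ⟨h.trans hj.1, hj.2.trans_le h'⟩

/-! ### Exchanging nonfaces on the old and new vertices -/

variable {V : Finset (α ⊕ Fin (k + 1))} {M : Set (Set (α ⊕ Fin (k + 1)))}

/-- The link of an edge of the short path with `p` vertices before and `k - p` vertices after the gap
is a cone over the new vertex at position `k - p`: an edge of the long path through this vertex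
contains, up to vertices of the short edge, another edge of the long path that avoids it. -/
theorem homotopyEquiv_add_shortEdges (hk : 2 ≤ k) (hM : ∀ f ∈ M, ∀ j, Sum.inr j ∉ f)
    (hold : Set.range (fun j => Sum.inl (a j)) ⊆ (V : Set (α ⊕ Fin (k + 1))))
    (hnew : ∀ j, Sum.inr j ∈ V) :
    Nonempty (ContinuousMap.HomotopyEquiv
      (polyhedron V (M ∪ leftEdge a '' {p | p < k} ∪ rightEdge a '' {q | q < k}))
      (polyhedron V (M ∪ leftEdge a '' {p | p < k} ∪ rightEdge a '' {q | q < k} ∪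
        (fun p => shortEdge a (p + 1)) '' {p | p < k - 1}))) := by
  refine homotopyEquiv_union_nonfaces _ (fun p => Sum.inr (Fin.ofNat (k + 1) (k - (p + 1)))) (k - 1)
    (fun p hp => ?_) (fun p hp => ?_) (fun p hp => hnew _) (fun p hp => inr_notMem_shortEdge)
    fun p hp => ?_
  · exact ⟨Sum.inl (a ⟨k - 1, by omega⟩),
      inl_mem_shortEdge.2 ⟨_, ⟨by simp only; omega, by simp only; omega⟩, rfl⟩⟩
  · refine Set.Subset.trans ?_ hold
    exact Set.image_subset_range _ _
  · have hval : ((Fin.ofNat (k + 1) (k - (p + 1)) : Fin (k + 1)) : ℕ) = k - (p + 1) := by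
      simp only [Fin.val_ofNat]
      exact Nat.mod_eq_of_lt (by omega)
    generalize Fin.ofNat (k + 1) (k - (p + 1)) = w at hval ⊢
    rintro f (((hf | ⟨p', hp', rfl⟩) | ⟨q', hq', rfl⟩) | ⟨i, -, rfl⟩) hwf
    · exact absurd hwf (hM f hf _)
    · rw [inr_mem_leftEdge] at hwf
      refine ⟨leftEdge a (p + 1), Or.inl (Or.inl (Or.inr ⟨p + 1, show _ < k by omega, rfl⟩)), ?_⟩
      rintro (x | j) hx
      · exact Or.inr (oldRun_subset le_rfl (by omega) (hx.resolve_right inl_notMem_newRun))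
      · rw [inr_mem_leftEdge] at hx
        refine Or.inl ⟨inr_mem_leftEdge.2 (by omega), ?_⟩
        rintro h
        rw [Set.mem_singleton_iff, Sum.inr.injEq] at h
        omega
    · rw [inr_mem_rightEdge] at hwf
      refine ⟨rightEdge a (k - (p + 1)), Or.inl (Or.inr ⟨_, show _ < k by omega, rfl⟩), ?_⟩
      rintro (x | j) hx
      · exact Or.inr (oldRun_subset (by omega) (by omega) (hx.resolve_right inl_notMem_newRun))
      · rw [inr_mem_rightEdge] at hx
        refine Or.inl ⟨inr_mem_rightEdge.2 (by omega), ?_⟩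
        rintro h
        rw [Set.mem_singleton_iff, Sum.inr.injEq] at h
        omega
    · exact absurd hwf inr_notMem_shortEdge

/-- In the presence of the short path, `leftEdge a (p + 1)` may be dropped as long as
`leftEdge a p` is still there: the last new vertex is a cone point of its link. -/
theorem homotopyEquiv_add_leftEdges (hk : 2 ≤ k) (hM : ∀ f ∈ M, ∀ j, Sum.inr j ∉ f)
    (hshort : ∀ p, p < k - 1 → shortEdge a (p + 1) ∈ M)
    (hold : Set.range (fun j => Sum.inl (a j)) ⊆ (V : Set (α ⊕ Fin (k + 1))))
    (hnew : ∀ j, Sum.inr j ∈ V) :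
    Nonempty (ContinuousMap.HomotopyEquiv
      (polyhedron V (M ∪ {leftEdge a 0} ∪ rightEdge a '' {q | q < k}))
      (polyhedron V (M ∪ {leftEdge a 0} ∪ rightEdge a '' {q | q < k} ∪
        (fun p => leftEdge a (p + 1)) '' {p | p < k - 1}))) := by
  refine homotopyEquiv_union_nonfaces _ (fun _ => Sum.inr (Fin.last k)) (k - 1)
    (fun p hp => ?_) (fun p hp => ?_) (fun p hp => hnew _) (fun p hp => ?_) fun p hp => ?_
  · exact ⟨Sum.inr 0, inr_mem_leftEdge.2 (by simp only [Fin.val_zero]; omega)⟩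
  · rintro (x | j) hx
    · exact hold (Set.image_subset_range _ _ (hx.resolve_right inl_notMem_newRun))
    · exact hnew j
  · rw [inr_mem_leftEdge, Fin.val_last]
    omega
  · have hprev : ∃ g, g = leftEdge a p ∧ g ∈ M ∪ {leftEdge a 0} ∪ rightEdge a '' {q | q < k} ∪
        (fun p => leftEdge a (p + 1)) '' {j | j < p} := by
      refine ⟨_, rfl, ?_⟩
      rcases p with _ | p
      · exact Or.inl (Or.inl (Or.inr rfl))
      · exact Or.inr ⟨p, p.lt_succ_self, rfl⟩
    rintro f (((hf | rfl) | ⟨q, hq, rfl⟩) | ⟨i, -, rfl⟩) hwf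
    · exact absurd hwf (hM f hf _)
    · rw [inr_mem_leftEdge, Fin.val_last] at hwf
      omega
    · have hq' : q < k := hq
      -- `rightEdge a q` either contains the vertex that completes `leftEdge a p`,
      -- or its old vertices complete an edge of the short path.
      rcases lt_or_ge q (k - (p + 1)) with h | h
      · obtain ⟨g, rfl, hg⟩ := hprev
        refine ⟨_, hg, ?_⟩
        rintro (x | j) hx
        · exact Or.inr (Or.inl (oldRun_subset (by omega) le_rfl
            (hx.resolve_right inl_notMem_newRun)))
        · rw [inr_mem_leftEdge] at hx
          by_cases hj : (j : ℕ) < k - (p + 1)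
          · exact Or.inr (inr_mem_leftEdge.2 hj)
          · refine Or.inl ⟨inr_mem_rightEdge.2 (by omega), ?_⟩
            rintro h
            rw [Set.mem_singleton_iff, Sum.inr.injEq] at h
            rw [h, Fin.val_last] at hx
            omega
      · refine ⟨_, Or.inl (Or.inl (Or.inl (hshort p hp))), ?_⟩
        rintro (x | j) hx
        · obtain ⟨j, ⟨h1, h2⟩, rfl⟩ := inl_mem_shortEdge.1 hx
          by_cases hj : (j : ℕ) < k - 1
          · exact Or.inr (inl_mem_leftEdge.2 ⟨j, ⟨h1, hj⟩, rfl⟩)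
          · exact Or.inl ⟨inl_mem_rightEdge.2 ⟨j, ⟨by omega, by omega⟩, rfl⟩, by simp⟩
        · exact absurd hx inr_notMem_shortEdge
    · rw [inr_mem_leftEdge, Fin.val_last] at hwf
      omega

/-- The edge `rightEdge a (q + 1)` may be dropped as long as `rightEdge a q` is still there: the
first new vertex is a cone point of its link. -/
theorem homotopyEquiv_add_rightEdges (hM : ∀ f ∈ M, ∀ j, Sum.inr j ∉ f)
    (hold : Set.range (fun j => Sum.inl (a j)) ⊆ (V : Set (α ⊕ Fin (k + 1))))
    (hnew : ∀ j, Sum.inr j ∈ V) :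
    Nonempty (ContinuousMap.HomotopyEquiv
      (polyhedron V (M ∪ {leftEdge a 0} ∪ {rightEdge a 0}))
      (polyhedron V (M ∪ {leftEdge a 0} ∪ {rightEdge a 0} ∪
        (fun q => rightEdge a (q + 1)) '' {q | q < k - 1}))) := by
  refine homotopyEquiv_union_nonfaces _ (fun _ => Sum.inr 0) (k - 1)
    (fun q hq => ?_) (fun q hq => ?_) (fun q hq => hnew _) (fun q hq => ?_) fun q hq => ?_
  · exact ⟨Sum.inr (Fin.last k), inr_mem_rightEdge.2 (by simp only [Fin.val_last]; omega)⟩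
  · rintro (x | j) hx
    · exact hold (Set.image_subset_range _ _ (hx.resolve_right inl_notMem_newRun))
    · exact hnew j
  · rw [inr_mem_rightEdge, Fin.val_zero]
    omega
  · have hprev : ∃ g, g = rightEdge a q ∧ g ∈ M ∪ {leftEdge a 0} ∪ {rightEdge a 0} ∪
        (fun q => rightEdge a (q + 1)) '' {j | j < q} := by
      refine ⟨_, rfl, ?_⟩
      rcases q with _ | q
      · exact Or.inl (Or.inr rfl)
      · exact Or.inr ⟨q, q.lt_succ_self, rfl⟩
    rintro f (((hf | rfl) | rfl) | ⟨i, -, rfl⟩) hwf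
    · exact absurd hwf (hM f hf _)
    · obtain ⟨g, rfl, hg⟩ := hprev
      refine ⟨_, hg, ?_⟩
      rintro (x | j) hx
      · exact Or.inr (Or.inl (oldRun_subset le_rfl (by omega)
          (hx.resolve_right inl_notMem_newRun)))
      · rw [inr_mem_rightEdge] at hx
        by_cases hj : q + 2 ≤ (j : ℕ)
        · exact Or.inr (inr_mem_rightEdge.2 hj)
        · refine Or.inl ⟨inr_mem_leftEdge.2 (by omega), ?_⟩
          rintro h
          rw [Set.mem_singleton_iff, Sum.inr.injEq] at h
          rw [h, Fin.val_zero] at hx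
          omega
    · rw [inr_mem_rightEdge, Fin.val_zero] at hwf
      omega
    · rw [inr_mem_rightEdge, Fin.val_zero] at hwf
      omega

theorem image_setOf_lt_eq_union {k : ℕ} (hk : 1 ≤ k) {γ : Type*} (G : ℕ → γ) :
    G '' {p | p < k} = {G 0} ∪ (fun p => G (p + 1)) '' {p | p < k - 1} := by
  ext g
  constructor
  · rintro ⟨p, hp, rfl⟩
    rcases p with _ | p
    · exact Or.inl rfl
    · exact Or.inr ⟨p, show p < k - 1 from Nat.lt_sub_of_add_lt hp, rfl⟩
  · rintro (rfl | ⟨p, hp, rfl⟩)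
    · exact ⟨0, hk, rfl⟩
    · exact ⟨p + 1, show p + 1 < k from Nat.add_lt_of_lt_sub hp, rfl⟩

/-- The nonfaces of the join of the complex with nonfaces `M` and of the boundary of the simplex on
the first `n` new vertices. The other new vertices are deleted. -/
def joinBoundary (M : Set (Set (α ⊕ Fin (k + 1)))) (n : ℕ) : Set (Set (α ⊕ Fin (k + 1))) :=
  M ∪ {newRun α k 0 n} ∪ (fun j => {Sum.inr j}) '' {j : Fin (k + 1) | n ≤ (j : ℕ)}

/-- When the edges `leftEdge a 0` and `rightEdge a 0` on the first and on the last `k` new vertices are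
left, the link of the last new vertex is a cone over the first one, so the last new vertex can be
deleted, and `rightEdge a 0` with it. -/
theorem homotopyEquiv_joinBoundary (hk : 2 ≤ k) (hM : ∀ f ∈ M, ∀ j, Sum.inr j ∉ f)
    (hnew : ∀ j, Sum.inr j ∈ V) :
    Nonempty (ContinuousMap.HomotopyEquiv
      (polyhedron V (M ∪ {leftEdge a 0} ∪ {rightEdge a 0}))
      (polyhedron V (joinBoundary M k))) := by
  have hleft : leftEdge a 0 = newRun α k 0 k := by
    have : oldRun a (k - 1 - 0) (k - 1) = ∅ := by
      refine Set.image_eq_empty.2 (Set.eq_empty_of_forall_notMem fun j hj => ?_)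
      have := hj.1
      have := hj.2
      omega
    rw [leftEdge, this, Set.empty_union, Nat.sub_zero]
  obtain ⟨φ⟩ := homotopyEquiv_insert_nonface (V := V)
    (N := M ∪ {leftEdge a 0} ∪ {rightEdge a 0})
    (e := {Sum.inr (Fin.last k)}) (w := Sum.inr 0) (Set.singleton_nonempty _)
    (by simpa using hnew _) (hnew _) (by
      rw [Set.mem_singleton_iff, Sum.inr.injEq, Fin.ext_iff, Fin.val_zero, Fin.val_last]
      omega) (by
      rintro f ((hf | rfl) | rfl) hwf
      · exact absurd hwf (hM f hf _)
      · refine ⟨rightEdge a 0, Or.inr rfl, ?_⟩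
        rintro (x | j) hx
        · rw [inl_mem_rightEdge] at hx
          obtain ⟨j, hj, -⟩ := hx
          omega
        · rw [inr_mem_rightEdge] at hx
          by_cases hj : (j : ℕ) < k
          · refine Or.inl ⟨inr_mem_leftEdge.2 hj, ?_⟩
            rintro h
            rw [Set.mem_singleton_iff, Sum.inr.injEq] at h
            rw [h, Fin.val_zero] at hx
            omega
          · refine Or.inr ?_
            rw [Set.mem_singleton_iff, Sum.inr.injEq, Fin.ext_iff, Fin.val_last]
            omega
      · rw [inr_mem_rightEdge, Fin.val_zero] at hwf
        omega)
  obtain ⟨ψ⟩ : Nonempty (ContinuousMap.HomotopyEquiv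
      (polyhedron V (insert {Sum.inr (Fin.last k)} (M ∪ {leftEdge a 0} ∪ {rightEdge a 0})))
      (polyhedron V (joinBoundary M k))) := by
    refine TopCat.nonempty_homotopyEquiv_of_eq (polyhedron_congr ?_ ?_)
    · rintro f (rfl | (hf | rfl) | rfl)
      · exact ⟨_, Or.inr ⟨Fin.last k, by simp, rfl⟩, Set.Subset.rfl⟩
      · exact ⟨f, Or.inl (Or.inl hf), Set.Subset.rfl⟩
      · exact ⟨_, Or.inl (Or.inr rfl), hleft.ge⟩
      · refine ⟨_, Or.inr ⟨Fin.last k, by simp, rfl⟩, Set.singleton_subset_iff.2 ?_⟩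
        exact inr_mem_rightEdge.2 (by simp only [Fin.val_last]; omega)
    · rintro f ((hf | rfl) | ⟨j, hj, rfl⟩)
      · exact ⟨f, Or.inr (Or.inl (Or.inl hf)), Set.Subset.rfl⟩
      · exact ⟨_, Or.inr (Or.inl (Or.inr rfl)), hleft.le⟩
      · have hj' : k ≤ (j : ℕ) := hj
        have : j = Fin.last k := Fin.ext (by rw [Fin.val_last]; omega)
        exact ⟨_, Or.inl rfl, by rw [this]⟩
  exact ⟨φ.trans ψ⟩

/-- The boundary of a simplex with `n + 1` vertices is, up to homotopy and compatibly with joins, the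
suspension of the boundary of a simplex with `n` vertices. -/
theorem homotopyEquiv_joinBoundary_succ {n : ℕ} (hn : 1 ≤ n) (hnk : n + 1 ≤ k)
    (hM : ∀ f ∈ M, ∀ j, Sum.inr j ∉ f) (hnew : ∀ j, Sum.inr j ∈ V)
    (hne : Nonempty (polyhedron V (joinBoundary M n))) :
    Nonempty (ContinuousMap.HomotopyEquiv (polyhedron V (joinBoundary M (n + 1)))
      (suspension (polyhedron V (joinBoundary M n)))) := by
  let c : Fin (k + 1) := ⟨n, by omega⟩
  let d : Fin (k + 1) := ⟨n + 1, by omega⟩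
  have hcd : (Sum.inr c : α ⊕ Fin (k + 1)) ≠ Sum.inr d := by
    simp [c, d]
  let R : Set (Set (α ⊕ Fin (k + 1))) :=
    (fun j => {Sum.inr j}) '' {j : Fin (k + 1) | n + 2 ≤ (j : ℕ)}
  -- The vertex `d` is added with the edge `{c, d}`, which then makes the edge on the first
  -- `n + 1` new vertices replaceable by the one on the first `n` of them.
  let T : Set (Set (α ⊕ Fin (k + 1))) :=
    insert {Sum.inr c, Sum.inr d} (M ∪ {newRun α k 0 (n + 1)} ∪ R)
  obtain ⟨φ⟩ := homotopyEquiv_insert_nonface (V := V) (N := T)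
    (e := {Sum.inr d}) (w := Sum.inr 0) (Set.singleton_nonempty _)
    (by simpa using hnew _) (hnew _) (by
      rw [Set.mem_singleton_iff, Sum.inr.injEq, Fin.ext_iff]
      simp [d]) (by
      rintro f (rfl | (hf | rfl) | ⟨j, hj, rfl⟩) hwf
      · simp only [Set.mem_insert_iff, Set.mem_singleton_iff, Sum.inr.injEq, Fin.ext_iff, c, d,
          Fin.val_zero] at hwf
        omega
      · exact absurd hwf (hM f hf _)
      · refine ⟨_, Or.inl rfl, ?_⟩
        rintro _ (rfl | rfl)
        · refine Or.inl ⟨inr_mem_newRun.2 ⟨by omega, by simp [c]⟩, ?_⟩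
          rw [Set.mem_singleton_iff, Sum.inr.injEq, Fin.ext_iff]
          simp only [c, Fin.val_zero]
          omega
        · exact Or.inr rfl
      · rw [Set.mem_singleton_iff, Sum.inr.injEq] at hwf
        have hj' : n + 2 ≤ (j : ℕ) := hj
        rw [← hwf, Fin.val_zero] at hj'
        omega)
  obtain ⟨ψ⟩ := homotopyEquiv_insert_nonface (V := V) (N := T)
    (e := newRun α k 0 n) (w := Sum.inr d)
    ⟨Sum.inr 0, inr_mem_newRun.2 ⟨le_rfl, hn⟩⟩
    (by rintro _ ⟨j, -, rfl⟩; exact hnew j) (hnew _) (by simp [inr_mem_newRun, d]) (by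
      rintro f (rfl | (hf | rfl) | ⟨j, hj, rfl⟩) hwf
      · refine ⟨_, Or.inr (Or.inl (Or.inr rfl)), ?_⟩
        rintro _ ⟨j, ⟨-, hj⟩, rfl⟩
        by_cases hjn : (j : ℕ) < n
        · exact Or.inr (inr_mem_newRun.2 ⟨by omega, hjn⟩)
        · have : j = c := Fin.ext (by simp only [c]; omega)
          subst this
          exact Or.inl ⟨Or.inl rfl, hcd⟩
      · exact absurd hwf (hM f hf _)
      · simp [inr_mem_newRun, d] at hwf
      · rw [Set.mem_singleton_iff, Sum.inr.injEq] at hwf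
        have hj' : n + 2 ≤ (j : ℕ) := hj
        rw [← hwf] at hj'
        simp [d] at hj')
  have e1 : polyhedron V (insert {Sum.inr d} T) = polyhedron V (joinBoundary M (n + 1)) := by
    refine polyhedron_congr ?_ ?_
    · rintro f (rfl | rfl | (hf | rfl) | ⟨j, hj, rfl⟩)
      · exact ⟨_, Or.inr ⟨d, le_refl (n + 1), rfl⟩, Set.Subset.rfl⟩
      · exact ⟨_, Or.inr ⟨d, le_refl (n + 1), rfl⟩, by simp⟩
      · exact ⟨f, Or.inl (Or.inl hf), Set.Subset.rfl⟩
      · exact ⟨_, Or.inl (Or.inr rfl), Set.Subset.rfl⟩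
      · exact ⟨_, Or.inr ⟨j, (Nat.le_succ _).trans hj, rfl⟩, Set.Subset.rfl⟩
    · rintro f ((hf | rfl) | ⟨j, hj, rfl⟩)
      · exact ⟨f, Or.inr (Or.inr (Or.inl (Or.inl hf))), Set.Subset.rfl⟩
      · exact ⟨_, Or.inr (Or.inr (Or.inl (Or.inr rfl))), Set.Subset.rfl⟩
      · have hj' : n + 1 ≤ (j : ℕ) := hj
        refine ⟨_, ?_, Set.Subset.rfl⟩
        rcases hj'.eq_or_lt with h | h
        · have : j = d := Fin.ext (by simp only [d]; omega)
          exact Or.inl (by rw [this])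
        · exact Or.inr (Or.inr (Or.inr ⟨j, h, rfl⟩))
  have e2 : polyhedron V (insert (newRun α k 0 n) T) =
      polyhedron V (insert {Sum.inr c, Sum.inr d} (M ∪ {newRun α k 0 n} ∪ R)) := by
    refine polyhedron_congr ?_ ?_
    · rintro f (rfl | rfl | (hf | rfl) | hf)
      · exact ⟨_, Or.inr (Or.inl (Or.inr rfl)), Set.Subset.rfl⟩
      · exact ⟨_, Or.inl rfl, Set.Subset.rfl⟩
      · exact ⟨f, Or.inr (Or.inl (Or.inl hf)), Set.Subset.rfl⟩
      · exact ⟨_, Or.inr (Or.inl (Or.inr rfl)),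
          Set.image_mono fun j hj => ⟨hj.1, hj.2.trans n.lt_succ_self⟩⟩
      · exact ⟨f, Or.inr (Or.inr hf), Set.Subset.rfl⟩
    · rintro f (rfl | (hf | rfl) | hf)
      · exact ⟨_, Or.inr (Or.inl rfl), Set.Subset.rfl⟩
      · exact ⟨f, Or.inr (Or.inr (Or.inl (Or.inl hf))), Set.Subset.rfl⟩
      · exact ⟨_, Or.inl rfl, Set.Subset.rfl⟩
      · exact ⟨f, Or.inr (Or.inr (Or.inr hf)), Set.Subset.rfl⟩
  have e3 : polyhedron V (M ∪ {newRun α k 0 n} ∪ R ∪ {{Sum.inr c}, {Sum.inr d}}) =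
      polyhedron V (joinBoundary M n) := by
    congr 1
    ext f
    constructor
    · rintro (((hf | rfl) | ⟨j, hj, rfl⟩) | rfl | rfl)
      · exact Or.inl (Or.inl hf)
      · exact Or.inl (Or.inr rfl)
      · exact Or.inr ⟨j, (show n ≤ n + 2 by omega).trans hj, rfl⟩
      · exact Or.inr ⟨c, le_refl n, rfl⟩
      · exact Or.inr ⟨d, n.le_succ, rfl⟩
    · rintro ((hf | rfl) | ⟨j, hj, rfl⟩)
      · exact Or.inl (Or.inl (Or.inl hf))
      · exact Or.inl (Or.inl (Or.inr rfl))
      · have hj' : n ≤ (j : ℕ) := hj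
        by_cases h1 : (j : ℕ) = n
        · have : j = c := Fin.ext h1
          exact Or.inr (Or.inl (by rw [this]))
        by_cases h2 : (j : ℕ) = n + 1
        · have : j = d := Fin.ext h2
          exact Or.inr (Or.inr (by rw [this]; rfl))
        exact Or.inl (Or.inr ⟨j, show n + 2 ≤ (j : ℕ) by omega, rfl⟩)
  have key : ∀ m : Fin (k + 1), n ≤ (m : ℕ) → (m : ℕ) < n + 2 →
      ∀ e ∈ M ∪ {newRun α k 0 n} ∪ R, Sum.inr m ∉ e := by
    rintro m hm hm' e ((he | rfl) | ⟨j, hj, rfl⟩) h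
    · exact hM e he _ h
    · exact absurd (inr_mem_newRun.1 h).2 (by omega)
    · rw [Set.mem_singleton_iff, Sum.inr.injEq] at h
      have hj' : n + 2 ≤ (j : ℕ) := hj
      rw [← h] at hj'
      omega
  obtain ⟨χ⟩ := homotopyEquiv_suspension_polyhedron (V := V) (N := M ∪ {newRun α k 0 n} ∪ R) hcd
    (hnew c) (hnew d) (key c le_rfl (by simp [c])) (key d (by simp [d]) (by simp [d]))
    (e3 ▸ hne)
  obtain ⟨φ'⟩ := TopCat.nonempty_homotopyEquiv_of_eq e1
  obtain ⟨ψ'⟩ := TopCat.nonempty_homotopyEquiv_of_eq e2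
  obtain ⟨χ'⟩ := TopCat.nonempty_homotopyEquiv_of_eq (congrArg suspension e3)
  exact ⟨(φ.trans φ').symm.trans (ψ.trans (ψ'.trans (χ.trans χ')))⟩

end Path

/-! ### The independence complex of the subdivision -/

section Independence

variable {α : Type u} {k : ℕ}

theorem independenceSpace_eq_polyhedron (H : Hypergraph α) (hfin : H.vertexSet.Finite) :
    H.independenceSpace = polyhedron hfin.toFinset H.edgeSet := by
  have : H.independenceComplex = nonfaceComplex hfin.toFinset H.edgeSet := by
    simp only [Hypergraph.independenceComplex, nonfaceComplex, ← Finset.coe_subset,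
      Set.Finite.coe_toFinset]
  rw [Hypergraph.independenceSpace, this]

/-- When all the new vertices are deleted, what remains is the original complex. -/
theorem homotopyEquiv_joinBoundary_one (V : Finset α) (W : Finset (α ⊕ Fin (k + 1)))
    (hW : ∀ x, Sum.inl x ∈ W ↔ x ∈ V) (N : Set (Set α)) :
    Nonempty (ContinuousMap.HomotopyEquiv
      (polyhedron W (joinBoundary ((fun e => Sum.inl '' e) '' N) 1)) (polyhedron V N)) := by
  classical
  have hsum : ∀ x : α ⊕ Fin (k + 1) → ℝ, (∀ j, x (Sum.inr j) = 0) →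
      ∑ i ∈ W, x i = ∑ i ∈ V, x (Sum.inl i) := by
    intro x hx
    have : V.map Function.Embedding.inl ⊆ W := by
      intro i hi
      obtain ⟨v, hv, rfl⟩ := Finset.mem_map.1 hi
      exact (hW v).2 hv
    rw [← Finset.sum_subset this, Finset.sum_map]
    · rfl
    · rintro (v | j) hi hv
      · exact absurd (Finset.mem_map.2 ⟨v, (hW v).1 hi, rfl⟩) hv
      · exact hx j
  have hzero : ∀ x ∈ (nonfaceComplex W
      (joinBoundary ((fun e => Sum.inl '' e) '' N) 1)).realization, ∀ j, x (Sum.inr j) = 0 := by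
    intro x hx j
    obtain ⟨-, -, -, h⟩ := mem_realization_nonfaceComplex.1 hx
    rcases Nat.eq_zero_or_pos (j : ℕ) with hj | hj
    · obtain ⟨_, ⟨i, ⟨-, hi⟩, rfl⟩, hxi⟩ := h _ (Or.inl (Or.inr rfl))
      have : i = j := Fin.ext (by omega)
      exact this ▸ hxi
    · simpa using h _ (Or.inr ⟨j, hj, rfl⟩)
  refine ⟨Homeomorph.toHomotopyEquiv
    { toFun := fun x => ⟨fun i => x.1 (Sum.inl i), ?_⟩
      invFun := fun y => ⟨Sum.elim y.1 0, ?_⟩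
      left_inv := ?_
      right_inv := ?_
      continuous_toFun := ?_
      continuous_invFun := ?_ }⟩
  · obtain ⟨h0, hV, hs, hN⟩ := mem_realization_nonfaceComplex.1 x.2
    refine mem_realization_nonfaceComplex.2 ⟨fun i => h0 _, fun i hi => hV _ (by rwa [hW]), ?_,
      fun e he => ?_⟩
    · rw [← hsum _ (hzero _ x.2), hs]
    · obtain ⟨_, ⟨i, hi, rfl⟩, hxi⟩ := hN _ (Or.inl (Or.inl ⟨e, he, rfl⟩))
      exact ⟨i, hi, hxi⟩
  · obtain ⟨h0, hV, hs, hN⟩ := mem_realization_nonfaceComplex.1 y.2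
    refine mem_realization_nonfaceComplex.2 ⟨?_, ?_, ?_, ?_⟩
    · rintro (i | j)
      · exact h0 i
      · exact le_rfl
    · rintro (i | j) hi
      · exact hV i (by rwa [← hW])
      · rfl
    · rw [hsum _ fun j => rfl]
      exact hs
    · rintro _ ((⟨e, he, rfl⟩ | rfl) | ⟨j, -, rfl⟩)
      · obtain ⟨i, hi, hyi⟩ := hN e he
        exact ⟨Sum.inl i, ⟨i, hi, rfl⟩, hyi⟩
      · exact ⟨Sum.inr 0, inr_mem_newRun.2 ⟨le_rfl, by simp⟩, rfl⟩
      · exact ⟨_, rfl, rfl⟩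
  · intro x
    refine Subtype.ext (funext ?_)
    rintro (i | j)
    · rfl
    · exact (hzero _ x.2 j).symm
  · intro y
    rfl
  · refine Continuous.subtype_mk (continuous_pi fun i => ?_) _
    exact (continuous_apply (Sum.inl i)).comp continuous_subtype_val
  · refine Continuous.subtype_mk (continuous_pi ?_) _
    rintro (i | j)
    · exact (continuous_apply i).comp continuous_subtype_val
    · exact continuous_const

end Independence

theorem theorem4p3 {α : Type u} (H : Hypergraph α)
    (hfin : H.vertexSet.Finite)
    (hmin : IsAntichain (· ⊆ ·) H.edgeSet)
    (hsize : ∀ e ∈ H.edgeSet, 2 ≤ e.encard)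
    (k : ℕ) (hk : 2 ≤ k)
    (a : Fin (2 * k - 2) → α) (ha : Function.Injective a)
    (hP : H.Contains (tightPath k a)) :
    Nonempty (ContinuousMap.HomotopyEquiv
      (H.tightSubdivision k a hP.1).independenceSpace
      (suspension^[k - 1] H.independenceSpace)) := by
  have hfin' : (H.tightSubdivision k a hP.1).vertexSet.Finite :=
    (hfin.image _).union (Set.finite_range _)
  have hinl : ∀ x, Sum.inl x ∈ hfin'.toFinset ↔ x ∈ hfin.toFinset := by
    intro x
    simp [Hypergraph.tightSubdivision]
  have hnew : ∀ j, Sum.inr j ∈ hfin'.toFinset := by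
    intro j
    simp [Hypergraph.tightSubdivision]
  have hold : Set.range (fun j => Sum.inl (a j)) ⊆ (hfin'.toFinset : Set (α ⊕ Fin (k + 1))) := by
    rintro _ ⟨j, rfl⟩
    exact (hinl _).2 (hfin.mem_toFinset.2 (hP.1 ⟨j, rfl⟩))
  rw [independenceSpace_eq_polyhedron _ hfin', independenceSpace_eq_polyhedron H hfin]
  generalize hfin'.toFinset = V at hinl hnew hold ⊢
  let lift : Set α → Set (α ⊕ Fin (k + 1)) := fun e => Sum.inl '' e
  have hlift : ∀ S : Set (Set α), ∀ f ∈ lift '' S, ∀ j, Sum.inr j ∉ f := by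
    rintro S _ ⟨e, -, rfl⟩ j ⟨x, -, hx⟩
    cases hx
  let M := lift '' H.edgeSet
  have hM : ∀ f ∈ M, ∀ j, Sum.inr j ∉ f := hlift _
  have hMK : lift '' (H.edgeSet \ (tightPath k a).edgeSet) ∪
      (fun p => shortEdge a (p + 1)) '' {p | p < k - 1} = M := by
    rw [← image_edgeSet_tightPath hk, ← Set.image_union, Set.sdiff_union_of_subset hP.2]
  -- Add the edges of the short path, then drop the edges of the long path one by one.
  obtain ⟨φ₁⟩ := homotopyEquiv_add_shortEdges (a := a) hk
    (hlift (H.edgeSet \ (tightPath k a).edgeSet)) hold hnew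
  obtain ⟨φ₂⟩ := homotopyEquiv_add_leftEdges (a := a) hk hM
    (fun p hp => hMK ▸ Or.inr ⟨p, hp, rfl⟩) hold hnew
  obtain ⟨φ₃⟩ := homotopyEquiv_add_rightEdges (a := a) hM hold hnew
  obtain ⟨φ₄⟩ := homotopyEquiv_joinBoundary (a := a) hk hM hnew
  have hE : (H.tightSubdivision k a hP.1).edgeSet =
      lift '' (H.edgeSet \ (tightPath k a).edgeSet) ∪ leftEdge a '' {p | p < k} ∪
        rightEdge a '' {q | q < k} := by
    rw [Set.union_assoc, ← edgeSet_tightPath_insertedSequence hk]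
    rfl
  have h₁₂ : lift '' (H.edgeSet \ (tightPath k a).edgeSet) ∪ leftEdge a '' {p | p < k} ∪
        rightEdge a '' {q | q < k} ∪ (fun p => shortEdge a (p + 1)) '' {p | p < k - 1} =
      M ∪ {leftEdge a 0} ∪ rightEdge a '' {q | q < k} ∪
        (fun p => leftEdge a (p + 1)) '' {p | p < k - 1} := by
    rw [← hMK, image_setOf_lt_eq_union (by omega) (leftEdge a)]
    ac_rfl
  have h₂₃ : M ∪ {leftEdge a 0} ∪ {rightEdge a 0} ∪
        (fun q => rightEdge a (q + 1)) '' {q | q < k - 1} =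
      M ∪ {leftEdge a 0} ∪ rightEdge a '' {q | q < k} := by
    rw [image_setOf_lt_eq_union (by omega) (rightEdge a), Set.union_assoc]
  obtain ⟨ψ₀⟩ := TopCat.nonempty_homotopyEquiv_of_eq (congrArg (polyhedron V) hE)
  obtain ⟨ψ₁⟩ := TopCat.nonempty_homotopyEquiv_of_eq (congrArg (polyhedron V) h₁₂)
  obtain ⟨ψ₂⟩ := TopCat.nonempty_homotopyEquiv_of_eq (congrArg (polyhedron V) h₂₃)
  have hred : Nonempty (ContinuousMap.HomotopyEquiv
      (polyhedron V (H.tightSubdivision k a hP.1).edgeSet) (polyhedron V (joinBoundary M k))) :=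
    ⟨ψ₀.trans (φ₁.trans (ψ₁.trans (φ₂.symm.trans (ψ₂.symm.trans (φ₃.symm.trans φ₄)))))⟩
  -- Edges have at least two elements, so every vertex is a point of the polyhedron.
  have hne : ∀ n, 1 ≤ n → Nonempty (polyhedron V (joinBoundary M n)) := by
    classical
    intro n hn
    let v : α := a ⟨0, by omega⟩
    refine ⟨⟨Pi.single (Sum.inl v) 1, mem_realization_nonfaceComplex.2
      ⟨fun i => ?_, fun i hi => ?_, ?_, ?_⟩⟩⟩
    · by_cases h : i = Sum.inl v
      · simp [h]
      · simp [h]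
    · have : i ≠ Sum.inl v := fun h => hi (h ▸ hold ⟨_, rfl⟩)
      simp [this]
    · have : Sum.inl v ∈ V := hold ⟨_, rfl⟩
      simp [this]
    · rintro _ ((⟨e, he, rfl⟩ | rfl) | ⟨j, -, rfl⟩)
      · obtain ⟨x, hx, hxv⟩ := Set.exists_ne_of_one_lt_encard
          (lt_of_lt_of_le (by norm_num) (hsize e he)) v
        exact ⟨Sum.inl x, ⟨x, hx, rfl⟩, by simp [hxv]⟩
      · exact ⟨Sum.inr 0, inr_mem_newRun.2 ⟨le_rfl, hn⟩, by simp⟩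
      · exact ⟨Sum.inr j, rfl, by simp⟩
  have hsusp : ∀ n < k, Nonempty (ContinuousMap.HomotopyEquiv
      (polyhedron V (joinBoundary M (n + 1)))
      (suspension^[n] (polyhedron hfin.toFinset H.edgeSet))) := by
    intro n
    induction n with
    | zero => exact fun _ => homotopyEquiv_joinBoundary_one _ V hinl _
    | succ n ih =>
      intro hn
      obtain ⟨χ₁⟩ := homotopyEquiv_joinBoundary_succ n.succ_pos (by omega) hM hnew
        (hne _ n.succ_pos)
      obtain ⟨χ₂⟩ := homotopyEquiv_suspension (ih (by omega))
      rw [Function.iterate_succ_apply']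
      exact ⟨χ₁.trans χ₂⟩
  obtain ⟨φ⟩ := hred
  obtain ⟨χ⟩ := hsusp (k - 1) (by omega)
  obtain ⟨ψ⟩ := TopCat.nonempty_homotopyEquiv_of_eq
    (congrArg (fun n => polyhedron V (joinBoundary M n)) (show k = k - 1 + 1 by omega))
  exact ⟨φ.trans (ψ.trans χ)⟩
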